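/- Let $R$ be a finite ring, associative with identity, that is Frobenius: $R/\mathrm{Rad}(R)\cong\mathrm{Soc}(R_R)$ as right $R$-modules and $R/\mathrm{Rad}(R)\cong\mathrm{Soc}({}_RR)$ as left $R$-modules. Let $E=\{1,\dots,n\}$, let $C$ be a left $R$-linear code of length $n$ (a left $R$-submodule of $R^n$), and let $C^{\perp}=\{u\in R^n : \sum_{i} v_iu_i=0 \text{ for all } v\in C\}$ be its right dual code. Let $m,d\ge 0$ be integers and $f\in\mathrm{Harm}_d(n)$, that is, $f$ is a real-valued function on the $d$-element subsets of $E$ such that $\sum_{|Z|=d,\,Y\subseteq Z}f(Z)=0$ for every $Y\subseteq E$ with $|Y|=d-1$ (no condition if $d=0$). For $X\subseteq E$ put $\widetilde f(X)=\sum_{Z\subseteq X,\,|Z|=d}f(Z)$ and $\alpha_C(X)=\log_{|R|}|C\setminus(E-X)|$, where $C\setminus(E-X)\subseteq R^{|X|}$ is the punctured code obtained by deleting the coordinates in $E-X$ from every codeword of $C$. (For the zero ring, read $\alpha_C=0$.) For a left or right linear code $D$ of length $n$, the $m$-tuple harmonic weight enumerator of $D$ associated to $f$ is $$W^{[m]}_{D,f}(x,y)=\sum_{X\subseteq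 E}\widetilde f(X)\,A^{[m]}_D(X)\,x^{|E-X|}y^{|X|},$$ where $A^{[m]}_D(X)$ is the number of $m$-tuples $(u_1,\dots,u_m)\in D^m$ with $\mathrm{supp}(u_1)\cup\dots\cup\mathrm{supp}(u_m)=X$; and $Z^{[m]}_{D,f}(x,y)$ denotes the polynomial determined by $W^{[m]}_{D,f}(x,y)=(xy)^d\,Z^{[m]}_{D,f}(x,y)$. Then $W^{[m]}_{C^{\perp},f}$ is divisible by $(xy)^d$, so that $Z^{[m]}_{C^{\perp},f}$ is well defined, and $$Z^{[m]}_{C^{\perp},f}(x,y)=\sum_{\substack{X\subseteq E\\ d\le|X|\le n-d}}\widetilde f(X)\,(|R|^m)^{d-\alpha_C(X)}\,(x-y)^{|E-X|-d}\,(|R|^m y)^{|X|-d}.$$ -/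

import Mathlib

open MvPolynomial

namespace HarmonicCodes

/-! ### Finite Frobenius rings -/

/-- The socle of a module: the sum of all its simple submodules. -/
def socle (S M : Type*) [Ring S] [AddCommGroup M] [Module S M] : Submodule S M :=
  sSup {N : Submodule S M | IsSimpleModule S N}

/-- The Jacobson radical of `R`, a two-sided ideal, as a right `R`-submodule of `R`.
Right `R`-modules are modules over the opposite ring `Rᵐᵒᵖ`. -/
def radRight (R : Type*) [Ring R] : Submodule Rᵐᵒᵖ R where
  carrier := {a | a ∈ Ring.jacobson R}
  add_mem' := fun ha hb => (Ring.jacobson R).add_mem ha hb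
  zero_mem' := (Ring.jacobson R).zero_mem
  smul_mem' := fun c _ ha => Ideal.mul_mem_right c.unop (Ring.jacobson R) ha

/-- The Frobenius condition for a finite ring: `R / Rad(R)` is isomorphic to the socle of `R`,
both as right modules and as left modules. -/
structure IsFrobenius (R : Type*) [Ring R] : Prop where
  right_iso : Nonempty ((R ⧸ radRight R) ≃ₗ[Rᵐᵒᵖ] socle Rᵐᵒᵖ R)
  left_iso : Nonempty ((R ⧸ Ring.jacobson R) ≃ₗ[R] socle R R)

/-! ### Discrete harmonic functions on `E = Fin n` -/

/-- The set `E_d` of `d`-element subsets of `E = Fin n`. -/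
abbrev DSubset (n d : ℕ) : Type := {Z : Finset (Fin n) // Z.card = d}

/-- The extension `f̃ (X) = ∑ f(Z)`, summed over the `d`-subsets `Z` of `X`. -/
noncomputable def tilde {n d : ℕ} (f : DSubset n d → ℝ) (X : Finset (Fin n)) : ℝ :=
  ∑ Z : DSubset n d with Z.1 ⊆ X, f Z

/-- The differentiation `γ`, the linear map sending a basis element `Z ∈ E_d` to the formal sum of
the `(d-1)`-subsets of `Z`. There are none when `d = 0`, so `γ = 0` in that case. -/
noncomputable def gamma (n d : ℕ) : (DSubset n d → ℝ) →ₗ[ℝ] (Finset (Fin n) → ℝ) :=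
  Fintype.linearCombination ℝ
    (fun Z : DSubset n d => ∑ Y ∈ Z.1.powerset with Y.card + 1 = d, Pi.single Y (1 : ℝ))

/-- `Harm_d(n)`, the kernel of `γ` on `ℝ E_d`. -/
noncomputable def Harm (n d : ℕ) : Submodule ℝ (DSubset n d → ℝ) :=
  LinearMap.ker (gamma n d)

/-! ### Codes -/

/-- The right dual code of a left linear code, a right `R`-submodule of `R^n`. -/
def rightDual {R : Type*} [Ring R] {n : ℕ} (C : Submodule R (Fin n → R)) :
    Submodule Rᵐᵒᵖ (Fin n → R) where
  carrier := {u | ∀ v ∈ C, v ⬝ᵥ u = 0}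
  add_mem' := fun ha hb v hv => by rw [dotProduct_add, ha v hv, hb v hv, add_zero]
  zero_mem' := fun v _ => dotProduct_zero v
  smul_mem' := fun c u hu v hv => by rw [dotProduct_smul, hu v hv, smul_zero]

/-- The punctured code `C \ T`: the coordinates in `T` are deleted from every codeword. -/
def puncture {R : Type*} [Ring R] {n : ℕ} (C : Submodule R (Fin n → R)) (T : Finset (Fin n)) :
    Submodule R ({i : Fin n // i ∉ T} → R) :=
  C.map (LinearMap.funLeft R R Subtype.val)

/-- `α_C(X) = log_{|R|} |C \ (E - X)|`. -/
noncomputable def alpha {R : Type*} [Ring R] {n : ℕ} (C : Submodule R (Fin n → R))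
    (X : Finset (Fin n)) : ℝ :=
  Real.logb (Nat.card R) (Nat.card (puncture C Xᶜ))

/-- The number `A_C^{[m]}(X)` of `m`-tuples of codewords whose supports have union `X`.
It depends only on the set of codewords, so it serves left and right codes alike. -/
noncomputable def countTuples {R : Type*} [Ring R] {n : ℕ} (m : ℕ) (C : Set (Fin n → R))
    (X : Finset (Fin n)) : ℕ :=
  Nat.card {u : Fin m → Fin n → R //
    (∀ j, u j ∈ C) ∧ (⋃ j, Function.support (u j)) = (X : Set (Fin n))}

/-- The `m`-tuple harmonic weight enumerator `W_{C,f}^{[m]}(x, y)`, with `x = X 0`, `y = X 1`. -/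
noncomputable def W {R : Type*} [Ring R] {n d : ℕ} (m : ℕ) (C : Set (Fin n → R))
    (f : DSubset n d → ℝ) : MvPolynomial (Fin 2) ℝ :=
  ∑ S : Finset (Fin n),
    MvPolynomial.C (tilde f S * (countTuples m C S : ℝ)) * X 0 ^ Sᶜ.card * X 1 ^ S.card

/-- `Z_{C,f}^{[m]}(x, y)`, the quotient of `W_{C,f}^{[m]}(x, y)` by the monomial `(x y) ^ d`. When
the monomial divides `W`, as it does for harmonic `f`, this is the unique polynomial `Z` with
`W = (x y) ^ d * Z`. -/
noncomputable def Z {R : Type*} [Ring R] {n d : ℕ} (m : ℕ) (C : Set (Fin n → R))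
    (f : DSubset n d → ℝ) : MvPolynomial (Fin 2) ℝ :=
  MvPolynomial.divMonomial (W m C f) (Finsupp.single 0 d + Finsupp.single 1 d)

end HarmonicCodes

/-! Let `B(S)` be the number of words of the dual code supported in `S`. Tuples with union of
supports inside `S` number `B(S)^m`, so Möbius inversion expresses `A^{[m]}` by signed sums of
`B^m`. After exchanging sums, `B(S)^m` is multiplied by a sum of `f̃(T)` over `T ⊇ S`. Harmonicity
evaluates it (`sum_tilde_superset`): the `d`-sets with `j` points outside `S` have `f`-sum `(-1)^j
(d choose j) f̃(S)`, and the binomial theorem yields `x^d (x-y)^{|E-S|-d}`.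

It remains to see that `B(S) = |R|^{|S| - α_C(S)}`. Dual words supported in `S` form the annihilator
of a punctured code, so the point is `|P^⊥| |P| = |R|^k`. This follows from `|Hom(M,R)| ≤ |M|` for
finite `M` (`card_hom_le`), since `R^k` attains equality. Induction reduces the bound to simple `M`.
There a functional lands in the socle, isomorphic to `R/Rad R`, and `Hom(M, R/Rad R)` embeds in the
dual of `M` over the division ring `End M`. -/

/-! ### Functionals on simple modules -/

/-- The Jacobson radical is semiprime: an element `a` with `a R a` in the radical is in it. -/
theorem Ring.mem_jacobson_of_forall_mul_mul_mem {R : Type*} [Ring R] {a : R}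
    (h : ∀ r : R, a * r * a ∈ Ring.jacobson R) : a ∈ Ring.jacobson R := by
  rw [Ring.jacobson, Module.jacobson, Submodule.mem_sInf]
  intro m hm
  -- If a maximal left ideal `m` misses `a`, then `1 = y + r a` with `y ∈ m`, so `a = a y + a r a`
  -- lies in `m`.
  by_contra ha
  have hsup : m ⊔ Submodule.span R {a} = ⊤ := by
    refine hm.2 _ (lt_of_le_of_ne le_sup_left fun he => ha ?_)
    rw [he]
    exact Submodule.mem_sup_right (Submodule.mem_span_singleton_self a)
  have h1 : (1 : R) ∈ m ⊔ Submodule.span R {a} := hsup ▸ Submodule.mem_top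
  obtain ⟨y, hy, z, hz, hyz⟩ := Submodule.mem_sup.1 h1
  obtain ⟨r, rfl⟩ := Submodule.mem_span_singleton.1 hz
  have h2 : a * r * a ∈ m := (sInf_le hm : Ring.jacobson R ≤ m) (h r)
  have h3 : a * y ∈ m := m.smul_mem a hy
  apply ha
  have h4 := m.add_mem h3 h2
  rwa [mul_assoc, ← mul_add, ← smul_eq_mul r a, hyz, mul_one] at h4

section Pairing

variable {R S : Type*} [Ring R] [AddCommGroup S] [Module R S] [IsSimpleModule R S]

theorem Ring.jacobson_le_ker_toSpanSingleton (s : S) :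
    Ring.jacobson R ≤ LinearMap.ker (LinearMap.toSpanSingleton R S s) := by
  intro a ha
  have := IsSemisimpleModule.jacobson_le_annihilator R S ha
  rw [LinearMap.mem_ker, LinearMap.toSpanSingleton_apply]
  exact Module.mem_annihilator.1 this s

/-- The action of `R ⧸ Rad R` on an element of a simple module. -/
def quotJacobsonToSpanSingleton (s : S) : (R ⧸ Ring.jacobson R) →ₗ[R] S :=
  (Ring.jacobson R).liftQ (LinearMap.toSpanSingleton R S s)
    (Ring.jacobson_le_ker_toSpanSingleton s)

@[simp]
theorem quotJacobsonToSpanSingleton_mk (s : S) (a : R) :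
    quotJacobsonToSpanSingleton s (Ideal.Quotient.mk (Ring.jacobson R) a) = a • s :=
  rfl

/-- A homomorphism from a simple module `S` to `R ⧸ Rad R` yields a functional on `S` regarded as
a vector space over its endomorphism ring. -/
def simpleFunctional (φ : S →ₗ[R] R ⧸ Ring.jacobson R) : S →ₗ[Module.End R S] Module.End R S where
  toFun s := quotJacobsonToSpanSingleton s ∘ₗ φ
  map_add' s s' := by
    ext t
    obtain ⟨a, ha⟩ := Submodule.Quotient.mk_surjective _ (φ t)
    simp [← ha]
  map_smul' δ s := by
    ext t
    obtain ⟨a, ha⟩ := Submodule.Quotient.mk_surjective _ (φ t)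
    simp [← ha]

theorem simpleFunctional_apply (φ : S →ₗ[R] R ⧸ Ring.jacobson R) (s t : S) :
    simpleFunctional φ s t = quotJacobsonToSpanSingleton s (φ t) :=
  rfl

/-- A representative `a` of `φ t` annihilates `S`, so modulo the radical `a r a` is `φ (a r t) = 0`;
semiprimeness puts `a` in the radical. -/
theorem eq_zero_of_simpleFunctional_eq_zero {φ : S →ₗ[R] R ⧸ Ring.jacobson R}
    (h : simpleFunctional φ = 0) : φ = 0 := by
  ext t
  obtain ⟨a, ha⟩ := Submodule.Quotient.mk_surjective _ (φ t)
  have hkill : ∀ s : S, a • s = 0 := fun s => by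
    have := congrArg (fun ψ => ψ s t) h
    simpa [simpleFunctional_apply, ← ha] using this
  rw [← ha, LinearMap.zero_apply, Submodule.Quotient.mk_eq_zero]
  refine Ring.mem_jacobson_of_forall_mul_mul_mem fun r => ?_
  rw [← Submodule.Quotient.mk_eq_zero, mul_assoc, ← smul_eq_mul, Submodule.Quotient.mk_smul,
    ← smul_eq_mul, Submodule.Quotient.mk_smul, ha, ← map_smul, ← map_smul, hkill, map_zero]

theorem simpleFunctional_injective :
    Function.Injective (simpleFunctional : (S →ₗ[R] R ⧸ Ring.jacobson R) → _) := by
  intro φ ψ h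
  rw [← sub_eq_zero]
  apply eq_zero_of_simpleFunctional_eq_zero
  ext s t
  have := congrArg (fun ψ => ψ s t) h
  simp only [simpleFunctional_apply] at this
  simp [simpleFunctional_apply, this]

end Pairing

theorem Nat.card_dual_eq {D V : Type*} [DivisionRing D] [AddCommGroup V] [Module D V] [Finite V] :
    Nat.card (V →ₗ[D] D) = Nat.card V := by
  let b := Module.Free.chooseBasis D V
  rw [← Nat.card_congr (b.constr ℕ (M' := D)).toEquiv, Nat.card_congr b.equivFun.toEquiv]

theorem card_hom_quot_jacobson_le {R S : Type*} [Ring R] [AddCommGroup S] [Module R S]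
    [IsSimpleModule R S] [Finite S] : Nat.card (S →ₗ[R] R ⧸ Ring.jacobson R) ≤ Nat.card S := by
  classical
  have : Finite (Module.End R S) := Finite.of_injective (fun f => (f : S → S)) DFunLike.coe_injective
  have : Finite (S →ₗ[Module.End R S] Module.End R S) :=
    Finite.of_injective (fun f => (f : S → _)) DFunLike.coe_injective
  let _ : DivisionRing (Module.End R S) := Module.End.instDivisionRing
  rw [← Nat.card_dual_eq (D := Module.End R S) (V := S)]
  exact Nat.card_le_card_of_injective _ simpleFunctional_injective

/-! ### Counting functionals over a finite Frobenius ring -/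

namespace HarmonicCodes

instance finite_quotient {R M : Type*} [Ring R] [AddCommGroup M] [Module R M] [Finite M]
    (N : Submodule R M) : Finite (M ⧸ N) :=
  Finite.of_surjective _ N.mkQ_surjective

instance finite_linearMap {R M N : Type*} [Ring R] [AddCommGroup M] [Module R M] [AddCommGroup N]
    [Module R N] [Finite M] [Finite N] : Finite (M →ₗ[R] N) :=
  Finite.of_injective (fun f => (f : M → N)) DFunLike.coe_injective

theorem range_le_socle {R S M : Type*} [Ring R] [AddCommGroup S] [Module R S]
    [IsSimpleModule R S] [AddCommGroup M] [Module R M] (φ : S →ₗ[R] M) :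
    LinearMap.range φ ≤ socle R M := by
  rcases eq_or_ne φ 0 with rfl | h
  · simp
  · have hinj : Function.Injective φ := φ.injective_of_ne_zero h
    exact le_sSup (IsSimpleModule.congr (LinearEquiv.ofInjective φ hinj).symm)

/-- A finite simple module over a finite Frobenius ring has at most as many functionals as
elements. -/
theorem card_hom_le_of_isSimpleModule {R S : Type*} [Ring R] [Finite R] (hR : IsFrobenius R)
    [AddCommGroup S] [Module R S] [IsSimpleModule R S] [Finite S] :
    Nat.card (S →ₗ[R] R) ≤ Nat.card S := by
  obtain ⟨e⟩ := hR.left_iso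
  refine le_trans ?_ (card_hom_quot_jacobson_le (R := R) (S := S))
  refine Nat.card_le_card_of_injective (fun φ : S →ₗ[R] R => e.symm.toLinearMap ∘ₗ
    φ.codRestrict (socle R R) fun s => range_le_socle φ ⟨s, rfl⟩) fun φ ψ h => ?_
  ext s
  have := congrArg (fun χ => (e (χ s) : R)) h
  simpa using this

/-- Left exactness of `Hom`: a functional vanishing on `N` factors through `M ⧸ N`. -/
theorem card_hom_le_mul {R M Q : Type*} [Ring R] [AddCommGroup M] [Module R M] [AddCommGroup Q]
    [Module R Q] [Finite M] [Finite Q] (N : Submodule R M) :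
    Nat.card (M →ₗ[R] Q) ≤ Nat.card (M ⧸ N →ₗ[R] Q) * Nat.card (N →ₗ[R] Q) := by
  let ρ : (M →ₗ[R] Q) →+ (N →ₗ[R] Q) :=
    { toFun := fun f => f.domRestrict N, map_zero' := rfl, map_add' := fun _ _ => rfl }
  rw [ρ.ker.card_eq_card_quotient_mul_card_addSubgroup,
    Nat.card_congr (QuotientAddGroup.quotientKerEquivRange ρ).toEquiv, mul_comm]
  refine Nat.mul_le_mul ?_ (Nat.card_le_card_of_injective _ Subtype.val_injective)
  refine Nat.card_le_card_of_injective (fun f : ρ.ker => N.liftQ f.1 fun x hx => ?_)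
    fun f g h => ?_
  · exact congrArg (fun ψ => ψ ⟨x, hx⟩) f.2
  · ext x
    exact congrArg (fun ψ => ψ (N.mkQ x)) h

/-- Over a finite Frobenius ring, a finite module has at most as many functionals as elements. -/
theorem card_hom_le {R : Type*} [Ring R] [Finite R] (hR : IsFrobenius R) (M : Type*)
    [AddCommGroup M] [Module R M] [Finite M] : Nat.card (M →ₗ[R] R) ≤ Nat.card M := by
  induction hk : Nat.card M using Nat.strong_induction_on generalizing M with
  | _ k ih =>
    subst hk
    rcases subsingleton_or_nontrivial M with hM | hM
    · rw [Nat.card_of_subsingleton (0 : M →ₗ[R] R), Nat.card_of_subsingleton (0 : M)]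
    · obtain ⟨N, hN, -⟩ := (IsAtomic.eq_bot_or_exists_atom_le (⊤ : Submodule R M)).resolve_left
        top_ne_bot
      have : IsSimpleModule R N := isSimpleModule_iff_isAtom.2 hN
      have hcard := N.card_eq_card_quotient_mul_card
      have hNt : 1 < Nat.card N := Finite.one_lt_card_iff_nontrivial.2 (IsSimpleModule.nontrivial R N)
      have hQ : 0 < Nat.card (M ⧸ N) := Nat.card_pos
      calc _ ≤ _ := card_hom_le_mul N
        _ ≤ Nat.card (M ⧸ N) * Nat.card N := Nat.mul_le_mul
            (ih _ (by rw [hcard]; nlinarith) _ rfl) (card_hom_le_of_isSimpleModule hR)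
        _ = _ := by rw [hcard, mul_comm]

/-- Right multiplication identifies functionals on `R^ι` with vectors. -/
def dotEquiv (R ι : Type*) [Ring R] [Fintype ι] [DecidableEq ι] : (ι → R) ≃ ((ι → R) →ₗ[R] R) where
  toFun w :=
    { toFun := fun v => v ⬝ᵥ w
      map_add' := fun _ _ => add_dotProduct _ _ _
      map_smul' := fun _ _ => smul_dotProduct _ _ _ }
  invFun g i := g (Pi.single i 1)
  left_inv w := by ext i; simp
  right_inv g := by
    refine LinearMap.pi_ext' fun i => LinearMap.ext_ring ?_
    simp

/-- Over a finite Frobenius ring, a submodule of `R^ι` and its right annihilator have complementary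
sizes. -/
theorem card_annihilator_mul_card {R ι : Type*} [Ring R] [Finite R] (hR : IsFrobenius R) [Fintype ι]
    (P : Submodule R (ι → R)) :
    Nat.card {w : ι → R // ∀ v ∈ P, v ⬝ᵥ w = 0} * Nat.card P = Nat.card R ^ Fintype.card ι := by
  classical
  have h1 : Nat.card {w : ι → R // ∀ v ∈ P, v ⬝ᵥ w = 0} = Nat.card ((ι → R) ⧸ P →ₗ[R] R) := by
    refine Nat.card_congr (Equiv.ofBijective
      (fun w => P.liftQ (dotEquiv R ι w.1) fun v hv => w.2 v hv) ⟨fun w w' h => ?_, fun g => ?_⟩)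
    · apply Subtype.ext
      apply (dotEquiv R ι).injective
      refine LinearMap.ext fun v => ?_
      exact congrArg (fun ψ => ψ (P.mkQ v)) h
    · refine ⟨⟨(dotEquiv R ι).symm (g ∘ₗ P.mkQ), fun v hv => ?_⟩, ?_⟩
      · change dotEquiv R ι _ v = 0
        rw [Equiv.apply_symm_apply]
        simp [(Submodule.Quotient.mk_eq_zero P).2 hv]
      · refine Submodule.linearMap_qext _ ?_
        simp
  have h2 : Nat.card (ι → R) ≤ _ :=
    (Nat.card_congr (dotEquiv R ι)).trans_le (card_hom_le_mul (Q := R) P)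
  have h3 := card_hom_le hR ((ι → R) ⧸ P)
  have h4 := card_hom_le hR P
  have h5 := P.card_eq_card_quotient_mul_card
  have h6 : Nat.card (ι → R) = Nat.card R ^ Fintype.card ι := by simp [Nat.card_fun]
  have h7 : 0 < Nat.card P := Nat.card_pos
  rw [h1, ← h6]
  -- Bounding `Hom` of the quotient gives `≤`; self-duality of `R^ι` together with the bound for `P`
  -- gives `≥`.
  refine le_antisymm ((Nat.mul_le_mul_right _ h3).trans_eq (by rw [h5, mul_comm])) (h2.trans (Nat.mul_le_mul_left _ h4))

end HarmonicCodes

/-! ### Sums over intervals of finite sets -/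

theorem sum_Icc_pow_mul_pow {α A : Type*} [DecidableEq α] [CommSemiring A] (a b : A)
    {T X : Finset α} (h : T ⊆ X) :
    ∑ S ∈ Finset.Icc T X, a ^ (X \ S).card * b ^ (S \ T).card = (a + b) ^ (X \ T).card := by
  rw [add_comm, ← Finset.sum_pow_mul_eq_add_pow b a (X \ T)]
  refine Finset.sum_bij' (fun S _ => S \ T) (fun U _ => T ∪ U) ?_ ?_ ?_ ?_ ?_
  · intro S hS
    exact Finset.mem_powerset.2 (Finset.sdiff_subset_sdiff (Finset.mem_Icc.1 hS).2 subset_rfl)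
  · intro U hU
    have hU' := Finset.mem_powerset.1 hU
    exact Finset.mem_Icc.2 ⟨Finset.subset_union_left,
      Finset.union_subset h (hU'.trans Finset.sdiff_subset)⟩
  · intro S hS
    exact Finset.union_sdiff_of_subset (Finset.mem_Icc.1 hS).1
  · intro U hU
    have hU' := Finset.mem_powerset.1 hU
    rw [Finset.union_sdiff_left, Finset.sdiff_eq_self_of_disjoint]
    exact Finset.disjoint_of_subset_left hU' Finset.sdiff_disjoint
  · intro S hS
    obtain ⟨h1, h2⟩ := Finset.mem_Icc.1 hS
    have h3 : (X \ T).card - (S \ T).card = (X \ S).card := by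
      rw [Finset.card_sdiff_of_subset h, Finset.card_sdiff_of_subset h1,
        Finset.card_sdiff_of_subset h2]
      have := Finset.card_le_card h1
      have := Finset.card_le_card h2
      omega
    rw [h3, mul_comm]

/-- Möbius inversion on the lattice of finite sets. -/
theorem sum_powerset_neg_one_pow_mul_sum_powerset {α A : Type*} [DecidableEq α] [CommRing A]
    (g : Finset α → A) (X : Finset α) :
    ∑ S ∈ X.powerset, (-1) ^ (X \ S).card * ∑ T ∈ S.powerset, g T = g X := by
  simp_rw [Finset.mul_sum]
  rw [Finset.sum_comm' (t' := X.powerset) (s' := fun T => Finset.Icc T X)]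
  · have key : ∀ T ∈ X.powerset,
        ∑ S ∈ Finset.Icc T X, (-1) ^ (X \ S).card * g T = if T = X then g X else 0 := by
      intro T hT
      have hT' := Finset.mem_powerset.1 hT
      have := sum_Icc_pow_mul_pow (-1 : A) 1 hT'
      simp only [one_pow, mul_one, neg_add_cancel] at this
      rw [← Finset.sum_mul, this]
      split_ifs with h
      · simp [h]
      · rw [zero_pow, zero_mul]
        intro h0
        exact h (hT'.antisymm (Finset.sdiff_eq_empty_iff_subset.1 (Finset.card_eq_zero.1 h0)))
    rw [Finset.sum_congr rfl key]
    simp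
  · intro S T
    simp only [Finset.mem_powerset, Finset.mem_Icc]
    exact ⟨fun h => ⟨⟨h.2, h.1⟩, h.2.trans h.1⟩, fun h => ⟨h.1.2, h.1.1⟩⟩

/-! ### Harmonic functions -/

namespace HarmonicCodes

/-- Pairing `γ f = 0` with `g` and moving `γ` to its adjoint. -/
theorem sum_mul_sum_facets {n d : ℕ} {f : DSubset n d → ℝ} (hf : f ∈ Harm n d)
    (g : Finset (Fin n) → ℝ) :
    ∑ Z : DSubset n d, f Z * ∑ Y ∈ Z.1.powerset with Y.card + 1 = d, g Y = 0 := by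
  have h0 : gamma n d f = 0 := hf
  have h1 : ∑ Y, gamma n d f Y * g Y = 0 := by simp [h0]
  rw [← h1]
  simp only [gamma, Fintype.linearCombination_apply, Finset.sum_apply, Pi.smul_apply, smul_eq_mul,
    Finset.sum_mul]
  rw [Finset.sum_comm]
  refine Finset.sum_congr rfl fun Z _ => ?_
  simp only [mul_assoc, ← Finset.mul_sum, Finset.sum_mul]
  rw [Finset.sum_comm]
  congr 1
  refine Finset.sum_congr rfl fun Y _ => ?_
  simp [Pi.single_apply]

theorem sum_facets_eq_sum_erase {n d : ℕ} (Z : DSubset n d) (g : Finset (Fin n) → ℝ) :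
    ∑ Y ∈ Z.1.powerset with Y.card + 1 = d, g Y = ∑ z ∈ Z.1, g (Z.1.erase z) := by
  symm
  refine Finset.sum_bij (fun z _ => Z.1.erase z) ?_ ?_ ?_ fun _ _ => rfl
  · intro z hz
    rw [Finset.mem_filter, Finset.mem_powerset]
    exact ⟨Finset.erase_subset _ _, (Finset.card_erase_add_one hz).trans Z.2⟩
  · intro z hz w _ h
    exact Finset.erase_injOn _ hz ‹_› h
  · intro Y hY
    rw [Finset.mem_filter, Finset.mem_powerset] at hY
    have hc : (Z.1 \ Y).card = 1 := by
      have := Z.2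
      rw [Finset.card_sdiff_of_subset hY.1]
      omega
    obtain ⟨z, hz⟩ := Finset.card_eq_one.1 hc
    have hzm : z ∈ Z.1 \ Y := hz ▸ Finset.mem_singleton_self z
    refine ⟨z, (Finset.mem_sdiff.1 hzm).1, ?_⟩
    rw [← Finset.sdiff_singleton_eq_erase, ← hz, Finset.sdiff_sdiff_eq_self hY.1]

/-- The sum of `f` over the `d`-subsets having exactly `j` elements outside `S`. -/
noncomputable def outsideSum {n d : ℕ} (f : DSubset n d → ℝ) (S : Finset (Fin n)) (j : ℕ) : ℝ :=
  ∑ Z : DSubset n d with (Z.1 \ S).card = j, f Z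

theorem outsideSum_zero {n d : ℕ} (f : DSubset n d → ℝ) (S : Finset (Fin n)) :
    outsideSum f S 0 = tilde f S := by
  simp [outsideSum, tilde, Finset.sdiff_eq_empty_iff_subset]

/-- Erasing a point of `Z ∩ S` keeps `|Z \ S|`; erasing one of `Z \ S` lowers it by one. -/
theorem card_erase_sdiff_indicator {n d : ℕ} (Z : DSubset n d) (S : Finset (Fin n)) (j : ℕ) :
    ∑ z ∈ Z.1, (if (Z.1.erase z \ S).card = j then (1 : ℝ) else 0) =
      (if (Z.1 \ S).card = j then (d : ℝ) - j else 0) +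
        if (Z.1 \ S).card = j + 1 then (j : ℝ) + 1 else 0 := by
  rw [← Finset.sum_inter_add_sum_sdiff Z.1 S]
  congr 1
  · have : ∀ z ∈ Z.1 ∩ S, (if (Z.1.erase z \ S).card = j then (1 : ℝ) else 0) =
        if (Z.1 \ S).card = j then 1 else 0 := by
      intro z hz
      rw [Finset.erase_sdiff_comm, Finset.erase_eq_of_notMem]
      simp [(Finset.mem_inter.1 hz).2]
    rw [Finset.sum_congr rfl this, Finset.sum_const, nsmul_eq_mul, mul_ite, mul_one, mul_zero]
    split_ifs with h
    · have h1 := Finset.card_inter_add_card_sdiff Z.1 S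
      rw [h, Z.2] at h1
      rw [eq_sub_iff_add_eq]
      exact_mod_cast h1
    · rfl
  · have : ∀ z ∈ Z.1 \ S, (if (Z.1.erase z \ S).card = j then (1 : ℝ) else 0) =
        if (Z.1 \ S).card = j + 1 then 1 else 0 := by
      intro z hz
      rw [Finset.erase_sdiff_comm]
      have := Finset.card_erase_add_one hz
      congr 1
      rw [← this, Nat.add_right_cancel_iff]
    rw [Finset.sum_congr rfl this, Finset.sum_const, nsmul_eq_mul, mul_ite, mul_one, mul_zero]
    split_ifs with h
    · rw [h]; push_cast; rfl
    · rfl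

theorem outsideSum_rec {n d : ℕ} {f : DSubset n d → ℝ} (hf : f ∈ Harm n d) (S : Finset (Fin n))
    (j : ℕ) : ((d : ℝ) - j) * outsideSum f S j + (j + 1) * outsideSum f S (j + 1) = 0 := by
  rw [← sum_mul_sum_facets hf fun Y => if (Y \ S).card = j then 1 else 0]
  simp_rw [sum_facets_eq_sum_erase, card_erase_sdiff_indicator, outsideSum, Finset.sum_filter,
    Finset.mul_sum, ← Finset.sum_add_distrib, mul_add, mul_ite, mul_zero, mul_comm]

theorem outsideSum_eq {n d : ℕ} {f : DSubset n d → ℝ} (hf : f ∈ Harm n d) (S : Finset (Fin n))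
    (j : ℕ) : outsideSum f S j = (-1) ^ j * d.choose j * tilde f S := by
  induction j with
  | zero => simp [outsideSum_zero]
  | succ j ih =>
    have h1 := outsideSum_rec hf S j
    have h2 : ((d.choose (j + 1) : ℝ)) * (j + 1) = d.choose j * ((d : ℝ) - j) := by
      rcases le_or_gt j d with h | h
      · rw [← Nat.cast_sub h]
        exact_mod_cast Nat.choose_succ_right_eq d j
      · simp [Nat.choose_eq_zero_of_lt h, Nat.choose_eq_zero_of_lt (h.trans (Nat.lt_succ_self j))]
    have h3 : (j : ℝ) + 1 ≠ 0 := by positivity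
    apply mul_left_cancel₀ h3
    rw [ih] at h1
    rw [pow_succ]
    linear_combination h1 + (-1) ^ j * tilde f S * h2

theorem tilde_eq_zero_of_card_lt {n d : ℕ} (f : DSubset n d → ℝ) {S : Finset (Fin n)}
    (h : S.card < d) : tilde f S = 0 := by
  refine Finset.sum_eq_zero fun Z hZ => ?_
  have := Finset.card_le_card (Finset.mem_filter.1 hZ).2
  have := Z.2
  omega

theorem tilde_eq_zero_of_card_compl_lt {n d : ℕ} {f : DSubset n d → ℝ} (hf : f ∈ Harm n d)
    {S : Finset (Fin n)} (h : Sᶜ.card < d) : tilde f S = 0 := by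
  -- No `d`-set fits outside `S`, while this sum equals `± f̃(S)`.
  have h1 : outsideSum f S d = 0 := by
    refine Finset.sum_eq_zero fun Z hZ => ?_
    have h2 := (Finset.mem_filter.1 hZ).2
    have : Z.1 \ S ⊆ Sᶜ := fun x hx => Finset.mem_compl.2 (Finset.mem_sdiff.1 hx).2
    have := Finset.card_le_card this
    omega
  rw [outsideSum_eq hf] at h1
  simpa using h1

/-- A harmonic function reproduces itself when `f̃` is summed over supersets with monomial
weights. -/
theorem sum_tilde_superset {n d : ℕ} {f : DSubset n d → ℝ} (hf : f ∈ Harm n d)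
    {A : Type*} [CommRing A] (φ : ℝ →+* A) (x y : A) (S : Finset (Fin n)) :
    ∑ T ∈ Finset.Icc S Finset.univ, φ (tilde f T) * x ^ Tᶜ.card * (-y) ^ (T \ S).card =
      φ (tilde f S) * x ^ d * (x - y) ^ (Sᶜ.card - d) := by
  -- For fixed `Z`, the sets `T` range over the supersets of `S ∪ Z`, and their sum is a power of `x
  -- - y`.
  have h1 : ∑ T ∈ Finset.Icc S Finset.univ, φ (tilde f T) * x ^ Tᶜ.card * (-y) ^ (T \ S).card =
      ∑ Z : DSubset n d, φ (f Z) * ((-y) ^ (Z.1 \ S).card * (x - y) ^ (Sᶜ.card - (Z.1 \ S).card)) := by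
    simp_rw [tilde, map_sum, Finset.sum_mul]
    rw [Finset.sum_comm' (t' := Finset.univ)
      (s' := fun Z : DSubset n d => Finset.Icc (S ∪ Z.1) Finset.univ)]
    · refine Finset.sum_congr rfl fun Z _ => ?_
      have hc : Sᶜ.card - (Z.1 \ S).card = (Finset.univ \ (S ∪ Z.1)).card := by
        have : Finset.univ \ (S ∪ Z.1) = Sᶜ \ (Z.1 \ S) := by ext i; simp; tauto
        have h2 : Z.1 \ S ⊆ Sᶜ := fun i hi => Finset.mem_compl.2 (Finset.mem_sdiff.1 hi).2
        rw [this, Finset.card_sdiff_of_subset h2]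
      rw [hc, sub_eq_add_neg, ← sum_Icc_pow_mul_pow x (-y) (Finset.subset_univ _), Finset.mul_sum,
        Finset.mul_sum]
      refine Finset.sum_congr rfl fun T hT => ?_
      have hT' := (Finset.mem_Icc.1 hT).1
      have h2 : (T \ S).card = (Z.1 \ S).card + (T \ (S ∪ Z.1)).card := by
        rw [← Finset.card_union_of_disjoint]
        · congr 1
          ext i
          have := @hT' i
          simp at this ⊢
          tauto
        · rw [Finset.disjoint_left]
          intro i; simp; tauto
      rw [h2, pow_add, Finset.compl_eq_univ_sdiff]
      ring
    · intro T Z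
      simp [Finset.union_subset_iff]
  have h2 : ∑ Z : DSubset n d, φ (f Z) * ((-y) ^ (Z.1 \ S).card *
      (x - y) ^ (Sᶜ.card - (Z.1 \ S).card)) = ∑ j ∈ Finset.range (d + 1),
        φ (outsideSum f S j) * ((-y) ^ j * (x - y) ^ (Sᶜ.card - j)) := by
    have hm : ∀ Z ∈ (Finset.univ : Finset (DSubset n d)),
        (Z.1 \ S).card ∈ Finset.range (d + 1) := fun Z _ => by
      have := Finset.card_le_card (Finset.sdiff_subset (s := Z.1) (t := S))
      rw [Z.2] at this
      exact Finset.mem_range_succ_iff.2 this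
    rw [← Finset.sum_fiberwise_of_maps_to hm]
    refine Finset.sum_congr rfl fun j _ => ?_
    rw [outsideSum, map_sum, Finset.sum_mul]
    exact Finset.sum_congr rfl fun Z hZ => by rw [(Finset.mem_filter.1 hZ).2]
  rw [h1, h2]
  -- When `|Sᶜ| < d` the truncated exponent is meaningless, but `f̃(S) = 0`.
  rcases lt_or_ge Sᶜ.card d with h | h
  · simp [outsideSum_eq hf, tilde_eq_zero_of_card_compl_lt hf h]
  · have h3 : x ^ d = ∑ j ∈ Finset.range (d + 1), y ^ j * (x - y) ^ (d - j) * d.choose j := by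
      rw [← add_pow]; ring
    rw [h3, Finset.mul_sum, Finset.sum_mul]
    refine Finset.sum_congr rfl fun j hj => ?_
    have h4 : Sᶜ.card - j = (d - j) + (Sᶜ.card - d) := by
      have := Finset.mem_range_succ_iff.1 hj
      omega
    have h5 : (-1 : A) ^ j * (-1) ^ j = 1 := by rw [← mul_pow]; simp
    rw [outsideSum_eq hf, h4, pow_add, neg_pow y]
    simp only [map_mul, map_pow, map_neg, map_one, map_natCast]
    linear_combination (d.choose j * φ (tilde f S) * y ^ j * (x - y) ^ (d - j) *
      (x - y) ^ (Sᶜ.card - d)) * h5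

/-! ### Weight enumerators and shortened codes -/

/-- The number of codewords supported in `S`. -/
noncomputable def shortenedCard {R : Type*} [Ring R] {n : ℕ} (D : Set (Fin n → R))
    (S : Finset (Fin n)) : ℕ :=
  Nat.card {u : Fin n → R // u ∈ D ∧ Function.support u ⊆ S}

theorem sum_countTuples_powerset {R : Type*} [Ring R] [Finite R] {n : ℕ} (m : ℕ)
    (D : Set (Fin n → R)) (S : Finset (Fin n)) :
    ∑ T ∈ S.powerset, countTuples m D T = shortenedCard D S ^ m := by
  classical
  have := Fintype.ofFinite R
  have h1 : shortenedCard D S ^ m =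
      ((Finset.univ : Finset (Fin m → Fin n → R)).filter
        fun u => ∀ j, u j ∈ D ∧ Function.support (u j) ⊆ S).card := by
    rw [← Fintype.card_subtype, ← Nat.card_eq_fintype_card, Nat.card_congr
      (Equiv.subtypePiEquivPi (p := fun (_ : Fin m) (u : Fin n → R) =>
        u ∈ D ∧ Function.support u ⊆ (S : Set (Fin n)))), Nat.card_pi]
    simp [shortenedCard]
  have hm : ∀ u ∈ ((Finset.univ : Finset (Fin m → Fin n → R)).filter
        fun u => ∀ j, u j ∈ D ∧ Function.support (u j) ⊆ S),
      (⋃ j, Function.support (u j)).toFinset ∈ S.powerset := by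
    intro u hu
    rw [Finset.mem_powerset, ← Finset.coe_subset, Set.coe_toFinset, Set.iUnion_subset_iff]
    exact fun j => ((Finset.mem_filter.1 hu).2 j).2
  rw [h1, Finset.card_eq_sum_card_fiberwise hm]
  refine Finset.sum_congr rfl fun T hT => ?_
  rw [countTuples, Nat.card_eq_fintype_card, Fintype.card_subtype]
  congr 1
  ext u
  simp only [Finset.mem_filter, Finset.mem_univ, true_and, ← Finset.coe_inj, Set.coe_toFinset]
  refine ⟨fun h => ⟨fun j => ⟨h.1 j, ?_⟩, h.2⟩, fun h => ⟨fun j => (h.1 j).1, h.2⟩⟩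
  refine ((Set.subset_iUnion (fun j => Function.support (u j)) j).trans h.2.le).trans ?_
  exact_mod_cast Finset.mem_powerset.1 hT

/-- The harmonic weight enumerator in terms of the numbers of codewords supported in each set. -/
theorem W_eq {R : Type*} [Ring R] [Finite R] {n d : ℕ} (m : ℕ)
    (D : Set (Fin n → R)) {f : DSubset n d → ℝ} (hf : f ∈ Harm n d) :
    W m D f = ∑ S : Finset (Fin n), C (tilde f S * (shortenedCard D S : ℝ) ^ m) *
      X 0 ^ d * (X 0 - X 1) ^ (Sᶜ.card - d) * X 1 ^ S.card := by
  have hA : ∀ T : Finset (Fin n), (countTuples m D T : ℝ) =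
      ∑ S ∈ T.powerset, (-1) ^ (T \ S).card * (shortenedCard D S : ℝ) ^ m := by
    intro T
    rw [← sum_powerset_neg_one_pow_mul_sum_powerset (fun T => (countTuples m D T : ℝ)) T]
    refine Finset.sum_congr rfl fun S _ => ?_
    rw [← Nat.cast_pow, ← sum_countTuples_powerset, Nat.cast_sum]
  have hB : ∀ S : Finset (Fin n), C (tilde f S * (shortenedCard D S : ℝ) ^ m) *
      X 0 ^ d * (X 0 - X 1) ^ (Sᶜ.card - d) * X 1 ^ S.card =
      ∑ T ∈ Finset.Icc S Finset.univ, C (tilde f T * ((-1) ^ (T \ S).card *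
        (shortenedCard D S : ℝ) ^ m)) * X 0 ^ Tᶜ.card * (X 1 : MvPolynomial (Fin 2) ℝ) ^ T.card := by
    intro S
    trans C ((shortenedCard D S : ℝ) ^ m) * X 1 ^ S.card *
      (C (tilde f S) * X 0 ^ d * (X 0 - X 1 : MvPolynomial (Fin 2) ℝ) ^ (Sᶜ.card - d))
    · rw [C_mul]; ring
    rw [← sum_tilde_superset hf C, Finset.mul_sum]
    refine Finset.sum_congr rfl fun T hT => ?_
    have h1 : T.card = S.card + (T \ S).card := by
      rw [add_comm, Finset.card_sdiff_add_card_eq_card (Finset.mem_Icc.1 hT).1]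
    rw [h1, neg_pow, pow_add]
    simp only [C_mul, C_pow, C_neg, C_1]
    ring
  simp_rw [hB, W, hA, Finset.mul_sum, map_sum, Finset.sum_mul]
  refine Finset.sum_comm' fun T S => ?_
  simp

/-- Shortening is dual to puncturing: restriction to `S`, with extension by zero as inverse, matches
dual words supported in `S` with the annihilator of the punctured code. -/
theorem card_shortened_dual_mul {R : Type*} [Ring R] [Finite R] (hR : IsFrobenius R) {n : ℕ}
    (K : Submodule R (Fin n → R)) (S : Finset (Fin n)) :
    shortenedCard (rightDual K : Set (Fin n → R)) S * Nat.card (puncture K Sᶜ) =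
      Nat.card R ^ S.card := by
  classical
  have hι : Fintype.card {i : Fin n // i ∉ Sᶜ} = S.card := by
    rw [Fintype.card_subtype]; congr 1; ext; simp
  rw [← hι, ← card_annihilator_mul_card hR (puncture K Sᶜ)]
  congr 1
  have hdot : ∀ v u : Fin n → R, Function.support u ⊆ S →
      (fun i : {i : Fin n // i ∉ Sᶜ} => v i) ⬝ᵥ (fun i => u i) = v ⬝ᵥ u := by
    intro v u hu
    rw [dotProduct, dotProduct, ← Finset.sum_subset (Finset.subset_univ S),
      ← Finset.sum_subtype S (p := fun i => i ∉ Sᶜ) (by simp) fun i => v i * u i]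
    intro i _ hi
    rw [Function.notMem_support.1 fun h => hi (hu h), mul_zero]
  let ext0 : ({i : Fin n // i ∉ Sᶜ} → R) → Fin n → R := fun w i =>
    if h : i ∉ Sᶜ then w ⟨i, h⟩ else 0
  have hext : ∀ w (i : {i : Fin n // i ∉ Sᶜ}), ext0 w i = w i := fun w i => dif_pos i.2
  have hsupp : ∀ w, Function.support (ext0 w) ⊆ S := by
    intro w i hi
    by_contra h
    exact hi (dif_neg (by simpa using h))
  refine Nat.card_congr
    { toFun := fun u => ⟨fun i => u.1 i, ?_⟩
      invFun := fun w => ⟨ext0 w.1, ?_, hsupp _⟩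
      left_inv := fun u => ?_
      right_inv := fun w => Subtype.ext (funext (hext w.1)) }
  · rintro _ ⟨v, hv, rfl⟩
    exact (hdot v u.1 u.2.2).trans (u.2.1 v hv)
  · intro v hv
    rw [← hdot v _ (hsupp _)]
    simp_rw [hext]
    exact w.2 _ ⟨v, hv, rfl⟩
  · apply Subtype.ext
    funext i
    by_cases h : i ∈ S
    · exact dif_pos (by simpa using h)
    · have h1 : u.1 i = 0 := Function.notMem_support.1 fun h' => h (u.2.2 h')
      rw [h1]
      exact dif_neg (by simpa using h)

theorem shortenedCard_dual_eq_rpow {R : Type*} [Ring R] [Finite R] (hR : IsFrobenius R) {n : ℕ}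
    (K : Submodule R (Fin n → R)) (S : Finset (Fin n)) :
    (shortenedCard (rightDual K : Set (Fin n → R)) S : ℝ) =
      (Nat.card R : ℝ) ^ ((S.card : ℝ) - alpha K S) := by
  have h := card_shortened_dual_mul hR K S
  have hp : 0 < Nat.card (puncture K Sᶜ) := Nat.card_pos
  have hp' : (0 : ℝ) < Nat.card (puncture K Sᶜ) := by exact_mod_cast hp
  have hq : 0 < Nat.card R := Nat.card_pos
  have hq' : (0 : ℝ) < Nat.card R := by exact_mod_cast hq
  have hα : (Nat.card R : ℝ) ^ alpha K S = Nat.card (puncture K Sᶜ) := by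
    -- Over the zero ring the base is `1`, so every power is `1`, as is the size of the punctured
    -- code.
    rcases Nat.eq_or_lt_of_le (Nat.one_le_iff_ne_zero.2 hq.ne') with h1 | h1
    · rw [← h1, one_pow, mul_eq_one] at h
      rw [← h1, h.2]; simp
    · exact Real.rpow_logb hq' (by exact_mod_cast h1.ne') hp'
  rw [Real.rpow_sub hq', hα, Real.rpow_natCast, eq_div_iff hp'.ne']
  exact_mod_cast h

end HarmonicCodes

/-! ### The identity for the dual code -/

theorem theorem3p6 {R : Type*} [Ring R] [Finite R] (hR : HarmonicCodes.IsFrobenius R)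
    (n d m : ℕ) (C : Submodule R (Fin n → R))
    (f : HarmonicCodes.DSubset n d → ℝ) (hf : f ∈ HarmonicCodes.Harm n d) :
    HarmonicCodes.W m (HarmonicCodes.rightDual C : Set (Fin n → R)) f =
        (X 0 * X 1) ^ d * HarmonicCodes.Z m (HarmonicCodes.rightDual C : Set (Fin n → R)) f ∧
      HarmonicCodes.Z m (HarmonicCodes.rightDual C : Set (Fin n → R)) f =
        ∑ S : Finset (Fin n) with d ≤ S.card ∧ S.card + d ≤ n,
          MvPolynomial.C (HarmonicCodes.tilde f S *
              ((Nat.card R : ℝ) ^ m) ^ ((d : ℝ) - HarmonicCodes.alpha C S)) *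
            (X 0 - X 1) ^ (Sᶜ.card - d) *
            (MvPolynomial.C ((Nat.card R : ℝ) ^ m) * X 1) ^ (S.card - d) := by
  have hq : (0 : ℝ) < Nat.card R := by exact_mod_cast Nat.card_pos (α := R)
  set Q : MvPolynomial (Fin 2) ℝ := ∑ S : Finset (Fin n) with d ≤ S.card ∧ S.card + d ≤ n,
    MvPolynomial.C (HarmonicCodes.tilde f S *
      ((Nat.card R : ℝ) ^ m) ^ ((d : ℝ) - HarmonicCodes.alpha C S)) *
    (X 0 - X 1) ^ (Sᶜ.card - d) *
    (MvPolynomial.C ((Nat.card R : ℝ) ^ m) * X 1) ^ (S.card - d) with hQ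
  have hW : HarmonicCodes.W m (HarmonicCodes.rightDual C : Set (Fin n → R)) f =
      (X 0 * X 1) ^ d * Q := by
    rw [HarmonicCodes.W_eq m _ hf, hQ, Finset.mul_sum, Finset.sum_filter]
    refine Finset.sum_congr rfl fun S _ => ?_
    split_ifs with h
    · have hcoef : (HarmonicCodes.shortenedCard
          (HarmonicCodes.rightDual C : Set (Fin n → R)) S : ℝ) ^ m =
          ((Nat.card R : ℝ) ^ m) ^ ((d : ℝ) - HarmonicCodes.alpha C S) *
            ((Nat.card R : ℝ) ^ m) ^ (S.card - d) := by
        rw [HarmonicCodes.shortenedCard_dual_eq_rpow hR, ← Real.rpow_natCast _ (S.card - d),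
          ← Real.rpow_add (by positivity), Nat.cast_sub h.1, ← Real.rpow_natCast,
          ← Real.rpow_natCast, ← Real.rpow_mul hq.le, ← Real.rpow_mul hq.le]
        congr 1
        ring
      have hX : (X 1 : MvPolynomial (Fin 2) ℝ) ^ S.card = X 1 ^ d * X 1 ^ (S.card - d) := by
        rw [← pow_add, Nat.add_sub_cancel' h.1]
      rw [hcoef, hX]
      simp only [C_mul, mul_pow, C_pow]
      ring
    · have : HarmonicCodes.tilde f S = 0 := by
        rcases lt_or_ge S.card d with h1 | h1
        · exact HarmonicCodes.tilde_eq_zero_of_card_lt f h1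
        · apply HarmonicCodes.tilde_eq_zero_of_card_compl_lt hf
          have := Finset.card_le_univ S
          rw [Finset.card_compl]
          simp only [Fintype.card_fin] at *
          omega
      simp [this]
  have hmon : (X 0 * X 1 : MvPolynomial (Fin 2) ℝ) ^ d =
      monomial (Finsupp.single 0 d + Finsupp.single 1 d) 1 := by
    rw [mul_pow, X_pow_eq_monomial, X_pow_eq_monomial, monomial_mul, one_mul]
  have hZ : HarmonicCodes.Z m (HarmonicCodes.rightDual C : Set (Fin n → R)) f = Q := by
    rw [HarmonicCodes.Z, hW, hmon, divMonomial_monomial_mul]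
  exact ⟨by rw [hZ, hW], hZ⟩
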